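/- Let $(\Omega,\mathcal F,(\mathcal F_t)_{t\ge0},\mathbb P)$ be a filtered probability space carrying a standard Brownian motion $B$ with respect to $(\mathcal F_t)$ (adapted, a.s. continuous paths, $B_t-B_s$ independent of $\mathcal F_s$ for $s\le t$), let $\mu,r\in\mathbb R$, $\sigma>0$, $x>0$, $P>0$, $\lambda_0,\lambda_1>0$, and let the wage process started at $x$ be the geometric Brownian motion $$X_t=x\exp\{(\mu-\tfrac12\sigma^2)t+\sigma B_t\},\qquad t\ge 0.$$ The subscript in $\mathbb E_x$ indicates $X_0=x$. Let the job-loss time $\tau_0$ be exponentially distributed with rate $\lambda_0$ and independent of $\mathcal F_\infty=\sigma(\bigcup_t\mathcal F_t)$. (If $(\mathcal F_t)$ is the filtration generated by $X$, this says that $\tau_0$ is independent of the process $X$.) Let $h$ be a benefit schedule, put $$H(t)=\int_0^t e^{-rs}h(s)\,ds,\qquad \beta=\int_0^\infty\lambda_1e^{-\lambda_1t}H(t)\,dt$$ (both integrals being assumed to converge absolutely), and put $\tilde r=r+\lambda_0$. Assume $\mu<\tilde r$. Define $$g(y)=\mathbb E_y\bigl(e^{-r\tau_0}\beta X_{\tau_0}\bigr)-P\quad(y>0),$$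 and, for every stopping time $\tau:\Omega\to[0,\infty]$ of $(\mathcal F_t)$, the expected net present value of entering the scheme at time $\tau$, $$\mathrm{eNPV}(x;\tau)=\mathbb E_x\Bigl[e^{-r\tau}\bigl(e^{-r(\tau_0-\tau)}\beta X_{\tau_0}-P\bigr)\mathbf 1_{\{\tau<\tau_0\}}\Bigr].$$ Then: (i) for all $y>0$ the expectation defining $g(y)$ is finite and $g(y)=\beta_1y-P$, where $\beta_1=\beta\lambda_0/(\tilde r-\mu)$; (ii) for every stopping time $\tau$, $$\mathrm{eNPV}(x;\tau)=\mathbb E_x\bigl[e^{-\tilde r\tau}g(X_\tau)\mathbf 1_{\{\tau<\infty\}}\bigr].$$ The random variables under both expectations have integrable positive parts; one is integrable if and only if the other is, and both are integrable whenever $\tilde r\ge0$ (if they are not integrable, both expectations are $-\infty$); (iii) consequently the problem of optimal entry is a perpetual optimal stopping problem: $$\sup_\tau \mathrm{eNPV}(x;\tau)=\sup_\tau\mathbb E_x\bigl[e^{-\tilde r\tau}g(X_\tau)\mathbf 1_{\{\tau<\infty\}}\bigr]<\infty,$$ the suprema being over all stopping times $\tau$ of $(\mathcal F_t)$ for which the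 expectation is finite. -/

import Mathlib

open MeasureTheory ProbabilityTheory
open scoped NNReal

noncomputable section

namespace UnemploymentInsurance

variable {Ω : Type*} [MeasurableSpace Ω]

/-- `B` is a standard Brownian motion on the filtered probability space `(Ω, 𝓕, P)`: a Brownian
motion (with almost surely continuous paths) that is adapted to `𝓕` and whose increment over
`[s, t]` is independent of `𝓕 s`. -/
structure IsFilteredBrownian (B : ℝ≥0 → Ω → ℝ) (𝓕 : Filtration ℝ≥0 (‹MeasurableSpace Ω›))
    (P : Measure Ω) : Prop extends IsBrownianReal B P where
  measurable : ∀ t, Measurable[𝓕 t] (B t)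
  indep_increment : ∀ s t, s ≤ t →
    Indep (MeasurableSpace.comap (fun ω => B t ω - B s ω) inferInstance) (𝓕 s) P

/-- The wage process: the geometric Brownian motion with drift `μ`, volatility `σ` and initial
value `x`, driven by `B`. -/
def wage (μ σ : ℝ) (B : ℝ≥0 → Ω → ℝ) (x : ℝ) (t : ℝ≥0) (ω : Ω) : ℝ :=
  x * Real.exp ((μ - σ ^ 2 / 2) * t + σ * B t ω)

/-- `H t`, the value, discounted at rate `r` to the start of unemployment, of the payments made
according to the schedule `h` up to time `t`. -/
def discountedSchedule (r : ℝ) (h : ℝ → ℝ) (t : ℝ) : ℝ :=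
  ∫ s in (0 : ℝ)..t, Real.exp (-r * s) * h s

/-- The factor `β`: the mean of `H` at an exponential time of rate `lam₁`. -/
def benefitFactor (r lam₁ : ℝ) (h : ℝ → ℝ) : ℝ :=
  ∫ t in Set.Ioi (0 : ℝ), lam₁ * Real.exp (-lam₁ * t) * discountedSchedule r h t

/-- The discounted benefit `e^{-r τ₀} β X_{τ₀}` for the starting wage `x`. -/
def discountedBenefit (μ σ r β : ℝ) (B : ℝ≥0 → Ω → ℝ) (τ₀ : Ω → ℝ≥0) (x : ℝ) (ω : Ω) : ℝ :=
  Real.exp (-r * τ₀ ω) * (β * wage μ σ B x (τ₀ ω) ω)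

/-- The gain function `g x = E_x (e^{-r τ₀} β X_{τ₀}) - prem` of immediate entry. -/
def gain (P : Measure Ω) (μ σ r β prem : ℝ) (B : ℝ≥0 → Ω → ℝ) (τ₀ : Ω → ℝ≥0) (x : ℝ) : ℝ :=
  (∫ ω, discountedBenefit μ σ r β B τ₀ x ω ∂P) - prem

open scoped Classical in
/-- The net present value of entering the scheme at time `τ`,
`e^{-r τ} (e^{-r (τ₀ - τ)} β X_{τ₀} - prem) 1_{τ < τ₀}`. -/
def entryValue (μ σ r β prem : ℝ) (B : ℝ≥0 → Ω → ℝ) (τ₀ : Ω → ℝ≥0) (x : ℝ)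
    (τ : Ω → WithTop ℝ≥0) (ω : Ω) : ℝ :=
  if τ ω < (τ₀ ω : WithTop ℝ≥0) then
    Real.exp (-r * ((τ ω).untopD 0 : ℝ≥0)) *
      (Real.exp (-r * ((τ₀ ω : ℝ) - ((τ ω).untopD 0 : ℝ≥0))) * (β * wage μ σ B x (τ₀ ω) ω) - prem)
  else 0

/-- The expected net present value of entering the scheme at time `τ`. -/
def eNPV (P : Measure Ω) (μ σ r β prem : ℝ) (B : ℝ≥0 → Ω → ℝ) (τ₀ : Ω → ℝ≥0) (x : ℝ)
    (τ : Ω → WithTop ℝ≥0) : ℝ :=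
  ∫ ω, entryValue μ σ r β prem B τ₀ x τ ω ∂P

open scoped Classical in
/-- The reward of the perpetual stopping problem with discount rate `ρ` and gain function `G`,
`e^{-ρ τ} G(X_τ) 1_{τ < ∞}`. -/
def perpetualReward (μ σ ρ : ℝ) (G : ℝ → ℝ) (B : ℝ≥0 → Ω → ℝ) (x : ℝ)
    (τ : Ω → WithTop ℝ≥0) (ω : Ω) : ℝ :=
  if τ ω < ⊤ then
    Real.exp (-ρ * ((τ ω).untopD 0 : ℝ≥0)) * G (wage μ σ B x ((τ ω).untopD 0) ω)
  else 0

end UnemploymentInsurance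

end

/-! The value of entry is `β e^{-r τ₀} X_{τ₀}` minus `prem * e^{-r τ}`, both on `{τ < τ₀}`, and the
two nonnegative pieces can be treated separately. In the premium piece, `τ₀` is independent of the
filtration, so integrating it out turns the indicator into the survival probability `e^{-lam₀ τ}`.
This raises the discount rate from `r` to `r + lam₀` (`lintegral_discount_entry`). In the wage
piece, freeze `τ₀ = t`. On `{τ < t}` the martingale `exp (σ B_t - σ² t / 2)` has the same mean at
`τ` as at `t` (`lintegral_stopped_lt`), so under the expectation `X_t` may be replaced by `e^{μ (t -
τ)} X_τ`. Integrating `e^{(μ - r) t}` over `t > τ` against the exponential law then gives the factor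
`lam₀ / (r + lam₀ - μ)` (`lintegral_wage_entry`). No strong Markov property is needed.

Both identities are between integrals in `[0, ∞]`, so Tonelli applies without integrability. The
wage piece is always integrable, being dominated by the discounted wage at `τ₀`, whose mean is
finite since `μ < r + lam₀`. Integrability therefore depends on the premium piece alone, which is
bounded after the change of rate if `0 ≤ r + lam₀`. The case `τ = 0` yields the affine formula for
the gain. -/

namespace UnemploymentInsurance

open Filter Topology
open scoped ENNReal

/-! ### Optional sampling in continuous time, by rounding stopping times up to a grid. -/

section Discretization

variable {Ω : Type*} {mΩ : MeasurableSpace Ω}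

/-- The first point after `u` of the grid `(n + 1)⁻¹ ℕ`. -/
noncomputable def nextGrid (n : ℕ) (u : ℝ≥0) : ℝ≥0 :=
  (⌊(n + 1 : ℝ≥0) * u⌋₊ + 1 : ℝ≥0) / (n + 1)

/-- The first point after `u` of the grid `(n + 1)⁻¹ ℕ`, capped at `t`. -/
noncomputable def gridAfter (n : ℕ) (t u : ℝ≥0) : ℝ≥0 :=
  min t (nextGrid n u)

lemma tendsto_nextGrid (u : ℝ≥0) : Tendsto (fun n : ℕ => nextGrid n u) atTop (𝓝 u) := by
  have hone : Tendsto (fun n : ℕ => u + 1 / ((n : ℝ≥0) + 1)) atTop (𝓝 u) := by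
    simpa using tendsto_const_nhds.add (tendsto_one_div_add_atTop_nhds_zero_nat (𝕜 := ℝ≥0))
  refine tendsto_of_tendsto_of_tendsto_of_le_of_le tendsto_const_nhds hone (fun n => ?_)
    (fun n => ?_)
  · have hn : (0 : ℝ≥0) < (n : ℝ≥0) + 1 := by positivity
    simp only [nextGrid]
    rw [le_div_iff₀ hn, mul_comm]
    exact (Nat.lt_floor_add_one _).le
  · have hn : (0 : ℝ≥0) < (n : ℝ≥0) + 1 := by positivity
    have h := Nat.floor_le (zero_le (a := ((n : ℝ≥0) + 1) * u))
    have e : (u + 1 / ((n : ℝ≥0) + 1)) * (n + 1) = (n + 1) * u + 1 := by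
      field_simp
    simp only [nextGrid]
    rw [div_le_iff₀ hn, e]
    gcongr

lemma tendsto_gridAfter {t u : ℝ≥0} (hut : u ≤ t) :
    Tendsto (fun n : ℕ => gridAfter n t u) atTop (𝓝 u) := by
  simpa [gridAfter, min_eq_right hut] using
    (tendsto_const_nhds (x := t)).min (tendsto_nextGrid u)

/-- Rounding up needs no knowledge of the future: whether the rounded time has occurred by `s < t`
depends only on whether `u` precedes the last grid point up to `s`. -/
lemma isStoppingTime_gridAfter {𝓕 : Filtration ℝ≥0 mΩ} {u : Ω → ℝ≥0}
    (hu : IsStoppingTime 𝓕 (fun ω => (u ω : WithTop ℝ≥0))) (n : ℕ) (t : ℝ≥0) :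
    IsStoppingTime 𝓕 (fun ω => (gridAfter n t (u ω) : WithTop ℝ≥0)) := by
  intro s
  have hn : (0 : ℝ≥0) < (n : ℝ≥0) + 1 := by positivity
  by_cases hts : t ≤ s
  · have : {ω | (gridAfter n t (u ω) : WithTop ℝ≥0) ≤ s} = Set.univ := by
      refine Set.eq_univ_of_forall fun ω => WithTop.coe_le_coe.2 ?_
      exact (min_le_left _ _).trans hts
    rw [this]
    exact MeasurableSet.univ
  -- The last grid point up to `s`. The inequality `u < k` below is strict because `nextGrid` lies
  -- strictly after its argument, even at grid points.
  · set k : ℝ≥0 := (⌊((n : ℝ≥0) + 1) * s⌋₊ : ℝ≥0) / (n + 1) with hk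
    have hks : k ≤ s := by
      rw [hk, div_le_iff₀ hn, mul_comm]
      exact Nat.floor_le zero_le
    have : {ω | (gridAfter n t (u ω) : WithTop ℝ≥0) ≤ s}
        = {ω | (u ω : WithTop ℝ≥0) < (k : WithTop ℝ≥0)} := by
      ext ω
      simp only [Set.mem_ofPred_eq, WithTop.coe_le_coe, WithTop.coe_lt_coe, gridAfter, nextGrid, min_le_iff,
        hts, false_or]
      rw [div_le_iff₀ hn, hk, lt_div_iff₀ hn, mul_comm s, mul_comm (u ω),
        ← Nat.floor_lt zero_le, ← Nat.succ_le_iff, Nat.le_floor_iff zero_le]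
      push_cast
      rfl
    rw [this]
    exact hu.measurableSet_lt_le hks

lemma countable_range_gridAfter (u : Ω → ℝ≥0) (n : ℕ) (t : ℝ≥0) :
    (Set.range (fun ω => (gridAfter n t (u ω) : WithTop ℝ≥0))).Countable := by
  refine (Set.countable_range
    (fun k : ℕ => ((min t (((k : ℝ≥0) + 1) / (n + 1)) : ℝ≥0) : WithTop ℝ≥0))).mono ?_
  rintro _ ⟨ω, rfl⟩
  exact ⟨⌊(n + 1 : ℝ≥0) * u ω⌋₊, rfl⟩

/-- **Optional sampling** for a martingale with almost surely continuous paths at a bounded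
stopping time. -/
theorem optional_sampling_of_continuous {P : Measure Ω} [IsProbabilityMeasure P]
    {𝓕 : Filtration ℝ≥0 mΩ} {M : ℝ≥0 → Ω → ℝ} (hM : Martingale M 𝓕 P)
    (hc : ∀ᵐ ω ∂P, Continuous (M · ω)) {u : Ω → ℝ≥0}
    (hu : IsStoppingTime 𝓕 (fun ω => (u ω : WithTop ℝ≥0))) {t : ℝ≥0} (hut : ∀ ω, u ω ≤ t) :
    Integrable (fun ω => M (u ω) ω) P ∧ ∫ ω, M (u ω) ω ∂P = ∫ ω, M t ω ∂P := by
  have hst := isStoppingTime_gridAfter hu (t := t)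
  have hle : ∀ n ω, (gridAfter n t (u ω) : WithTop ℝ≥0) ≤ t :=
    fun n ω => WithTop.coe_le_coe.2 (min_le_left _ _)
  have hcond : ∀ n, (fun ω => M (gridAfter n t (u ω)) ω)
      =ᵐ[P] P[M t | (hst n).measurableSpace] := fun n => by
    have := hM.stoppedValue_ae_eq_condExp_of_le_const_of_countable_range (hst n) (hle n)
      (countable_range_gridAfter u n t)
    exact this
  have hint : ∀ n, Integrable (fun ω => M (gridAfter n t (u ω)) ω) P :=
    fun n => integrable_condExp.congr (hcond n).symm
  have hmean : ∀ n, ∫ ω, M (gridAfter n t (u ω)) ω ∂P = ∫ ω, M t ω ∂P := fun n => by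
    rw [integral_congr_ae (hcond n), integral_condExp]
  have hlim : ∀ᵐ ω ∂P, Tendsto (fun n => M (gridAfter n t (u ω)) ω) atTop (𝓝 (M (u ω) ω)) := by
    filter_upwards [hc] with ω hω
    exact (hω.tendsto _).comp (tendsto_gridAfter (hut ω))
  -- All approximants are conditional expectations of the single integrable variable `M t`, hence
  -- uniformly integrable; this upgrades almost sure convergence to convergence in L¹.
  have hUI : UniformIntegrable (fun n ω => M (gridAfter n t (u ω)) ω) 1 P :=
    ((hM.integrable t).uniformIntegrable_condExp
      (fun n => (hst n).measurableSpace_le)).ae_eq (fun n => (hcond n).symm)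
  have hmeas : AEStronglyMeasurable (fun ω => M (u ω) ω) P :=
    aestronglyMeasurable_of_tendsto_ae _ (fun n => (hint n).1) hlim
  have hmem : MemLp (fun ω => M (u ω) ω) 1 P := hUI.memLp_of_ae_tendsto hlim
  have hL1 := tendsto_Lp_finite_of_tendsto_ae le_rfl ENNReal.one_ne_top
    (fun n => (hint n).1) hmem hUI.unifIntegrable hlim
  have hI := memLp_one_iff_integrable.1 hmem
  refine ⟨hI, ?_⟩
  have := tendsto_integral_of_L1' _ hI.1 (Eventually.of_forall hint) hL1
  simp only [hmean] at this
  exact tendsto_nhds_unique tendsto_const_nhds this |>.symm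

/-- A continuous martingale has, on the event that a stopping time precedes `t`, the same mean at
that stopping time and at `t`. -/
theorem lintegral_stopped_lt {P : Measure Ω} [IsProbabilityMeasure P]
    {𝓕 : Filtration ℝ≥0 mΩ} {M : ℝ≥0 → Ω → ℝ} (hM : Martingale M 𝓕 P)
    (hc : ∀ᵐ ω ∂P, Continuous (M · ω)) (hpos : ∀ s ω, 0 ≤ M s ω) {τ : Ω → WithTop ℝ≥0}
    (hτ : IsStoppingTime 𝓕 τ) (t : ℝ≥0) :
    ∫⁻ ω in {ω | τ ω < t}, ENNReal.ofReal (M t ω) ∂P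
      = ∫⁻ ω in {ω | τ ω < t}, ENNReal.ofReal (M ((τ ω).untopD 0) ω) ∂P := by
  -- The minimum is finite, so the default value 0 is never used here.
  set u : Ω → ℝ≥0 := fun ω => (min (τ ω) t).untopD 0
  have hcoe : ∀ ω, (u ω : WithTop ℝ≥0) = min (τ ω) t := fun ω => by
    have h : min (τ ω) t ≠ ⊤ := ((min_le_right _ _).trans_lt (WithTop.coe_lt_top t)).ne
    lift min (τ ω) t to ℝ≥0 using h with v hv
    simp only [u, ← hv, WithTop.untopD_coe]
  have hu : IsStoppingTime 𝓕 (fun ω => (u ω : WithTop ℝ≥0)) := by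
    simp only [hcoe]
    exact hτ.min_const t
  have hut : ∀ ω, u ω ≤ t := fun ω => by
    rw [← WithTop.coe_le_coe, hcoe]
    exact min_le_right _ _
  obtain ⟨hI, hE⟩ := optional_sampling_of_continuous hM hc hu hut
  set A : Set Ω := {ω | τ ω < t}
  have hA : MeasurableSet A := 𝓕.le t _ (hτ.measurableSet_lt t)
  have hon : ∀ ω ∈ A, u ω = (τ ω).untopD 0 := fun ω hω => by
    simp only [u, min_eq_left (show τ ω ≤ t from le_of_lt hω)]
  have hoff : ∀ ω ∈ Aᶜ, u ω = t := fun ω hω => by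
    have : (t : WithTop ℝ≥0) ≤ τ ω := not_lt.1 hω
    simp only [u, min_eq_right this, WithTop.untopD_coe]
  have h1 := integral_add_compl hA hI
  have h2 := integral_add_compl hA (hM.integrable t)
  -- Off `A` the capped time equals `t`, so these contributions agree and cancel from the equality
  -- of the full means.
  rw [setIntegral_congr_fun hA.compl (g := M t) (fun ω hω => by simp only [hoff ω hω])] at h1
  have h3 : ∫ ω in A, M (u ω) ω ∂P = ∫ ω in A, M t ω ∂P := by linarith
  calc ∫⁻ ω in A, ENNReal.ofReal (M t ω) ∂P = ∫⁻ ω in A, ENNReal.ofReal (M (u ω) ω) ∂P := by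
        rw [← ofReal_integral_eq_lintegral_ofReal hI.integrableOn
            (Eventually.of_forall fun ω => hpos _ ω),
          ← ofReal_integral_eq_lintegral_ofReal (hM.integrable t).integrableOn
            (Eventually.of_forall fun ω => hpos _ ω), h3]
    _ = ∫⁻ ω in A, ENNReal.ofReal (M ((τ ω).untopD 0) ω) ∂P :=
        setLIntegral_congr_fun hA fun ω hω => by simp only [hon ω hω]

end Discretization

/-! ### Jointly measurable evaluation of paths. -/

section PathLimit

/-- The value at `t` of the path `w`, read off from its values on a grid; it is jointly measurable
and agrees with `w t` for continuous `w`. -/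
noncomputable def pathLim (t : ℝ≥0) (w : ℝ≥0 → ℝ) : ℝ :=
  limUnder atTop (fun n : ℕ => w (nextGrid n t))

lemma pathLim_of_continuous {w : ℝ≥0 → ℝ} (hw : Continuous w) (t : ℝ≥0) : pathLim t w = w t :=
  ((hw.tendsto t).comp (tendsto_nextGrid t)).limUnder_eq

/-- Each approximant evaluates the path at one of countably many grid points, so it is measurable
jointly in the time and the path although the product space carries no regularity of paths. -/
lemma measurable_pathLim : Measurable (fun p : ℝ≥0 × (ℝ≥0 → ℝ) => pathLim p.1 p.2) := by
  refine (StronglyMeasurable.limUnder fun n => Measurable.stronglyMeasurable ?_).measurable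
  have h : Measurable (fun q : ℕ × (ℝ≥0 → ℝ) => q.2 (((q.1 : ℝ≥0) + 1) / (n + 1))) :=
    measurable_from_prod_countable_right fun k => measurable_pi_apply (((k : ℝ≥0) + 1) / (n + 1))
  exact h.comp (((Nat.measurable_floor (R := ℝ≥0)).comp (measurable_fst.const_mul _)).prodMk
    measurable_snd)

end PathLimit

/-! ### Integrating out an independent exponential time. -/

section Independence

variable {Ω E T : Type*} {mΩ : MeasurableSpace Ω} [MeasurableSpace E] [MeasurableSpace T]

/-- The mean of a nonnegative function of two independent random elements, computed by integrating
out the first one. -/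
lemma lintegral_comp_of_indepFun {P : Measure Ω} [IsProbabilityMeasure P] {S : Ω → T} {Y : Ω → E}
    (hS : Measurable S) (hY : Measurable Y) (hind : IndepFun S Y P) {f : T × E → ℝ≥0∞}
    (hf : Measurable f) :
    ∫⁻ ω, f (S ω, Y ω) ∂P = ∫⁻ ω, ∫⁻ t, f (t, Y ω) ∂(P.map S) ∂P := by
  have := Measure.isProbabilityMeasure_map hS.aemeasurable (μ := P)
  have := Measure.isProbabilityMeasure_map hY.aemeasurable (μ := P)
  rw [← lintegral_map hf (hS.prodMk hY),
    (indepFun_iff_map_prod_eq_prod_map_map hS.aemeasurable hY.aemeasurable).1 hind,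
    lintegral_prod_symm _ hf.aemeasurable, lintegral_map hf.lintegral_prod_left' hY]

/-- The integral over `(u, ∞)` of an exponential against the exponential distribution. -/
lemma lintegral_exp_expMeasure_Ioi {lam c u : ℝ} (hlam : 0 < lam) (hc : c < lam) (hu : 0 ≤ u) :
    ∫⁻ t in Set.Ioi u, ENNReal.ofReal (Real.exp (c * t)) ∂(expMeasure lam)
      = ENNReal.ofReal (lam / (lam - c) * Real.exp (-(lam - c) * u)) := by
  have hpos : 0 < lam - c := sub_pos.2 hc
  rw [show expMeasure lam = volume.withDensity (exponentialPDF lam) from rfl,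
    restrict_withDensity measurableSet_Ioi,
    lintegral_withDensity_eq_lintegral_mul₀ (by
      exact (measurable_exponentialPDFReal lam).ennreal_ofReal.aemeasurable)
      (by fun_prop)]
  have h1 : ∫⁻ t in Set.Ioi u, (exponentialPDF lam * fun t => ENNReal.ofReal (Real.exp (c * t))) t
      = ∫⁻ t in Set.Ioi u, ENNReal.ofReal (lam * Real.exp (-(lam - c) * t)) := by
    refine setLIntegral_congr_fun measurableSet_Ioi fun t ht => ?_
    simp only [Pi.mul_apply]
    rw [exponentialPDF_of_nonneg (hu.trans (le_of_lt ht)), ← ENNReal.ofReal_mul (by positivity),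
      mul_assoc, ← Real.exp_add]
    ring_nf
  rw [h1, ← ofReal_integral_eq_lintegral_ofReal
    ((integrableOn_exp_mul_Ioi (by linarith) u).const_mul lam)
    (Eventually.of_forall fun t => by positivity), integral_const_mul,
    integral_exp_mul_Ioi (by linarith)]
  congr 1
  field_simp

end Independence

/-! ### The exponential martingale of Brownian motion. -/

section Brownian

variable {Ω : Type*} {mΩ : MeasurableSpace Ω}

/-- The exponential martingale `exp (σ B_t - σ² t / 2)`. -/
noncomputable def expMart (σ : ℝ) (B : ℝ≥0 → Ω → ℝ) (t : ℝ≥0) (ω : Ω) : ℝ :=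
  Real.exp (-(σ ^ 2 / 2) * t + σ * B t ω)

lemma expMart_pos (σ : ℝ) (B : ℝ≥0 → Ω → ℝ) (t : ℝ≥0) (ω : Ω) : 0 < expMart σ B t ω :=
  Real.exp_pos _

lemma wage_eq_expMart (μ σ : ℝ) (B : ℝ≥0 → Ω → ℝ) (x : ℝ) (t : ℝ≥0) (ω : Ω) :
    wage μ σ B x t ω = x * (Real.exp (μ * t) * expMart σ B t ω) := by
  rw [wage, expMart, ← Real.exp_add]
  ring_nf

variable {P : Measure Ω} {𝓕 : Filtration ℝ≥0 mΩ} {B : ℝ≥0 → Ω → ℝ}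

lemma integrable_exp_of_hasLaw_gaussian {Z : Ω → ℝ} {v : ℝ≥0} (hZ : HasLaw Z (gaussianReal 0 v) P)
    (c : ℝ) : Integrable (fun ω => Real.exp (c * Z ω)) P := by
  have h := integrable_exp_mul_gaussianReal (μ := 0) (v := v) c
  rw [← hZ.map_eq] at h
  exact h.comp_aemeasurable hZ.aemeasurable

lemma integral_exp_of_hasLaw_gaussian {Z : Ω → ℝ} {v : ℝ≥0} (hZ : HasLaw Z (gaussianReal 0 v) P)
    (c : ℝ) : ∫ ω, Real.exp (c * Z ω) ∂P = Real.exp (v * c ^ 2 / 2) := by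
  simpa [mgf] using mgf_gaussianReal hZ.map_eq c

/-- The ratio `D` of the values at `t` and `s` is a function of the increment, hence independent of
`𝓕 s`. Its mean is one because the Gaussian moment `e^{σ² (t - s) / 2}` cancels the compensator. -/
lemma IsFilteredBrownian.martingale_expMart [IsProbabilityMeasure P]
    (hB : IsFilteredBrownian B 𝓕 P) (σ : ℝ) : Martingale (expMart σ B) 𝓕 P := by
  have hmeas : ∀ t, Measurable[𝓕 t] (expMart σ B t) := fun t =>
    Real.measurable_exp.comp ((hB.measurable t).const_mul σ |>.const_add _)
  have hint : ∀ t, Integrable (expMart σ B t) P := fun t => by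
    have := (integrable_exp_of_hasLaw_gaussian (hB.hasLaw_eval t) σ).const_mul
      (Real.exp (-(σ ^ 2 / 2) * t))
    refine this.congr (Eventually.of_forall fun ω => ?_)
    simp only [expMart, Real.exp_add]
  refine ⟨fun t => (hmeas t).stronglyMeasurable, fun s t hst => ?_⟩
  set D : Ω → ℝ := fun ω => Real.exp (-(σ ^ 2 / 2) * (t - s : ℝ)) * Real.exp (σ * (B t ω - B s ω))
  have hDlaw : HasLaw (fun ω => B t ω - B s ω) (gaussianReal 0 (nndist t.1 s.1)) P :=
    hB.hasLaw_sub t s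
  have hDint : Integrable D P := (integrable_exp_of_hasLaw_gaussian hDlaw σ).const_mul _
  have hDmean : ∫ ω, D ω ∂P = 1 := by
    have hst' : (s : ℝ) ≤ t := hst
    have hd : ((nndist t.1 s.1 : ℝ≥0) : ℝ) = t - s := by
      rw [coe_nndist, Real.dist_eq]
      exact abs_of_nonneg (sub_nonneg.2 hst')
    rw [integral_const_mul, integral_exp_of_hasLaw_gaussian hDlaw, hd, ← Real.exp_add,
      ← Real.exp_zero]
    ring_nf
  have hprod : expMart σ B t = expMart σ B s * D := by
    ext ω
    simp only [expMart, D, Pi.mul_apply, ← Real.exp_add]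
    ring_nf
  have hcomap : MeasurableSpace.comap (fun ω => B t ω - B s ω) inferInstance ≤ mΩ :=
    (((hB.measurable t).mono (𝓕.le t) le_rfl).sub
      ((hB.measurable s).mono (𝓕.le s) le_rfl)).comap_le
  have hDmeas : StronglyMeasurable[MeasurableSpace.comap (fun ω => B t ω - B s ω) inferInstance]
      D := by
    refine Measurable.stronglyMeasurable ?_
    exact ((Real.measurable_exp.comp (measurable_id.const_mul σ)).const_mul _).comp
      (comap_measurable (fun ω => B t ω - B s ω))
  have h1 := condExp_indep_eq hcomap (𝓕.le s) hDmeas (hB.indep_increment s t hst)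
  rw [hprod]
  refine (condExp_mul_of_stronglyMeasurable_left (hmeas s).stronglyMeasurable
    (hprod ▸ hint t) hDint).trans ?_
  filter_upwards [h1] with ω hω
  simp [hω, hDmean]

lemma IsFilteredBrownian.continuous_expMart (hB : IsFilteredBrownian B 𝓕 P) (σ : ℝ) :
    ∀ᵐ ω ∂P, Continuous (expMart σ B · ω) := by
  filter_upwards [hB.cont] with ω hω
  unfold expMart
  fun_prop

end Brownian

variable {Ω : Type*} {mΩ : MeasurableSpace Ω}

/-! ### Brownian paths at random times. -/

section RandomTimes

variable {P : Measure Ω} {𝓕 : Filtration ℝ≥0 mΩ} {B : ℝ≥0 → Ω → ℝ}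

lemma IsFilteredBrownian.measurable_path (hB : IsFilteredBrownian B 𝓕 P) :
    Measurable[⨆ t, 𝓕 t] (fun ω t => B t ω) :=
  (@measurable_pi_iff Ω _ _ (⨆ t, 𝓕 t) _ _).2 fun t =>
    (hB.measurable t).mono (le_iSup (fun t => 𝓕 t) t) le_rfl

/-- Both the path and `τ` are measurable with respect to `⨆ t, 𝓕 t`. Independence from the pair, not
merely from each component, is what allows `S` to be integrated out. -/
lemma IsFilteredBrownian.indepFun_path (hB : IsFilteredBrownian B 𝓕 P) {T : Type*}
    [MeasurableSpace T] {S : Ω → T}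
    (hS : Indep (MeasurableSpace.comap S inferInstance) (⨆ t, 𝓕 t) P) {τ : Ω → WithTop ℝ≥0}
    (hτ : IsStoppingTime 𝓕 τ) : IndepFun S (fun ω => ((fun t => B t ω), τ ω)) P := by
  rw [IndepFun_iff_Indep]
  exact indep_of_indep_of_le_right hS (hB.measurable_path.prodMk hτ.measurable_iSup).comap_le

lemma IsFilteredBrownian.measurable_path' (hB : IsFilteredBrownian B 𝓕 P) :
    Measurable (fun ω t => B t ω) :=
  hB.measurable_path.mono (iSup_le 𝓕.le) le_rfl

lemma IsFilteredBrownian.ae_pathLim (hB : IsFilteredBrownian B 𝓕 P) :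
    ∀ᵐ ω ∂P, ∀ t, pathLim t (fun s => B s ω) = B t ω := by
  filter_upwards [hB.cont] with ω hω t
  exact pathLim_of_continuous hω t

/-- The wage at a random time is a random variable. -/
lemma IsFilteredBrownian.aemeasurable_wage (hB : IsFilteredBrownian B 𝓕 P) (μ σ x : ℝ)
    {T : Ω → ℝ≥0} (hT : Measurable T) : AEMeasurable (fun ω => wage μ σ B x (T ω) ω) P := by
  have h : Measurable (fun ω => pathLim (T ω) (fun s => B s ω)) :=
    measurable_pathLim.comp (hT.prodMk hB.measurable_path')
  refine ⟨fun ω => x * Real.exp ((μ - σ ^ 2 / 2) * T ω + σ * pathLim (T ω) (fun s => B s ω)),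
    by fun_prop, ?_⟩
  filter_upwards [hB.ae_pathLim] with ω hω
  simp only [wage, hω]

end RandomTimes

/-! ### Replacing the job loss by additional discounting. -/

section JobLoss

variable {P : Measure Ω} {lam : ℝ} {τ₀ : Ω → ℝ≥0}

open scoped Classical in
/-- The mean of `e^{c τ₀}` on the event that the exponential time `τ₀` exceeds `s`. -/
lemma lintegral_exp_survival (hlam : 0 < lam) (hm : Measurable τ₀)
    (hlaw : HasLaw (fun ω => (τ₀ ω : ℝ)) (expMeasure lam) P) {c : ℝ} (hc : c < lam)
    (s : WithTop ℝ≥0) :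
    ∫⁻ t : ℝ≥0, (if s < (t : WithTop ℝ≥0) then ENNReal.ofReal (Real.exp (c * t)) else 0)
        ∂(P.map τ₀)
      = if s < ⊤ then
          ENNReal.ofReal (lam / (lam - c) * Real.exp (-(lam - c) * (s.untopD 0 : ℝ≥0))) else 0 := by
  induction s with
  | top => simp only [not_top_lt, if_false, lintegral_zero]
  | coe u =>
    simp only [WithTop.coe_lt_coe, WithTop.coe_lt_top, if_true, WithTop.untopD_coe]
    rw [← lintegral_exp_expMeasure_Ioi hlam hc u.coe_nonneg, ← lintegral_indicator measurableSet_Ioi,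
      ← hlaw.map_eq, lintegral_map (by measurability) hm.coe_nnreal_real, lintegral_map _ hm]
    · refine lintegral_congr fun ω => ?_
      simp [Set.indicator_apply]
    · exact Measurable.ite measurableSet_Ioi (by fun_prop) measurable_const

lemma ae_pos_of_expMeasure
    (hlaw : HasLaw (fun ω => (τ₀ ω : ℝ)) (expMeasure lam) P) : ∀ᵐ ω ∂P, 0 < τ₀ ω := by
  have h0 : ∀ᵐ y ∂(expMeasure lam), y ≠ 0 := by
    have hac : expMeasure lam ≪ volume := withDensity_absolutelyContinuous _ _
    exact hac.ae_le (Measure.ae_ne volume 0)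
  rw [← hlaw.map_eq] at h0
  filter_upwards [ae_of_ae_map hlaw.aemeasurable h0] with ω hω
  exact pos_iff_ne_zero.2 (by exact_mod_cast hω)

variable [IsProbabilityMeasure P] {𝓕 : Filtration ℝ≥0 mΩ} {B : ℝ≥0 → Ω → ℝ}

lemma measurableSet_lt_coe : MeasurableSet
    {p : ℝ≥0 × ((ℝ≥0 → ℝ) × WithTop ℝ≥0) | p.2.2 < (p.1 : WithTop ℝ≥0)} :=
  measurableSet_lt (by fun_prop) (WithTop.measurable_coe.comp measurable_fst)

open scoped Classical in
/-- The discounted probability of entering before the job loss. -/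
lemma lintegral_discount_entry (hB : IsFilteredBrownian B 𝓕 P) (hlam : 0 < lam)
    (hm : Measurable τ₀) (hlaw : HasLaw (fun ω => (τ₀ ω : ℝ)) (expMeasure lam) P)
    (hind : Indep (MeasurableSpace.comap τ₀ inferInstance) (⨆ t, 𝓕 t) P) (r : ℝ)
    {τ : Ω → WithTop ℝ≥0} (hτ : IsStoppingTime 𝓕 τ) :
    ∫⁻ ω, ENNReal.ofReal (if τ ω < (τ₀ ω : WithTop ℝ≥0) then
        Real.exp (-r * ((τ ω).untopD 0 : ℝ≥0)) else 0) ∂P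
      = ∫⁻ ω, ENNReal.ofReal (if τ ω < ⊤ then
          Real.exp (-(r + lam) * ((τ ω).untopD 0 : ℝ≥0)) else 0) ∂P := by
  have hf : Measurable (fun p : ℝ≥0 × ((ℝ≥0 → ℝ) × WithTop ℝ≥0) =>
      ENNReal.ofReal (if p.2.2 < (p.1 : WithTop ℝ≥0) then
        Real.exp (-r * (p.2.2.untopD 0 : ℝ≥0)) else 0)) :=
    (Measurable.ite measurableSet_lt_coe (by fun_prop) measurable_const).ennreal_ofReal
  refine (lintegral_comp_of_indepFun hm (hB.measurable_path'.prodMk hτ.measurable')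
    (hB.indepFun_path hind hτ) hf).trans (lintegral_congr fun ω => ?_)
  -- The exponent `c = 0` gives the survival probability.
  have hs := lintegral_exp_survival hlam hm hlaw hlam (τ ω)
  simp only [zero_mul, Real.exp_zero, sub_zero, div_self hlam.ne', one_mul] at hs
  have e : ∀ t : ℝ≥0, ENNReal.ofReal (if τ ω < (t : WithTop ℝ≥0) then
        Real.exp (-r * ((τ ω).untopD 0 : ℝ≥0)) else 0)
      = ENNReal.ofReal (Real.exp (-r * ((τ ω).untopD 0 : ℝ≥0)))
        * (if τ ω < (t : WithTop ℝ≥0) then ENNReal.ofReal 1 else 0) := fun t => by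
    split_ifs <;> simp
  simp only [e]
  rw [lintegral_const_mul' _ _ ENNReal.ofReal_ne_top, hs]
  split_ifs
  · rw [← ENNReal.ofReal_mul (by positivity), ← Real.exp_add]
    ring_nf
  · simp

open scoped Classical in
/-- The discounted wage at the job loss, on the event of an earlier entry, has the same mean as
the wage at entry discounted at the rate that accounts for the job loss, up to a factor. -/
lemma lintegral_wage_entry (hB : IsFilteredBrownian B 𝓕 P) (hlam : 0 < lam)
    (hm : Measurable τ₀) (hlaw : HasLaw (fun ω => (τ₀ ω : ℝ)) (expMeasure lam) P)
    (hind : Indep (MeasurableSpace.comap τ₀ inferInstance) (⨆ t, 𝓕 t) P) {μ σ r : ℝ}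
    (hμ : μ < r + lam) {x : ℝ} (hx : 0 < x) {τ : Ω → WithTop ℝ≥0} (hτ : IsStoppingTime 𝓕 τ) :
    ∫⁻ ω, ENNReal.ofReal (if τ ω < (τ₀ ω : WithTop ℝ≥0) then
        Real.exp (-r * τ₀ ω) * wage μ σ B x (τ₀ ω) ω else 0) ∂P
      = ENNReal.ofReal (lam / (r + lam - μ)) * ∫⁻ ω, ENNReal.ofReal (if τ ω < ⊤ then
          Real.exp (-(r + lam) * ((τ ω).untopD 0 : ℝ≥0))
            * wage μ σ B x ((τ ω).untopD 0) ω else 0) ∂P := by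
  set Y : Ω → (ℝ≥0 → ℝ) × WithTop ℝ≥0 := fun ω => ((fun t => B t ω), τ ω)
  have hY : Measurable Y := hB.measurable_path'.prodMk hτ.measurable'
  have := Measure.isProbabilityMeasure_map hm.aemeasurable (μ := P)
  set N : ℝ≥0 × (ℝ≥0 → ℝ) → ℝ≥0∞ := fun p =>
    ENNReal.ofReal (x * Real.exp (-(σ ^ 2 / 2) * p.1 + σ * pathLim p.1 p.2))
  have hN : Measurable N := by
    have := measurable_pathLim
    fun_prop
  have hNae : ∀ᵐ ω ∂P, ∀ t, N (t, (Y ω).1) = ENNReal.ofReal (x * expMart σ B t ω) := by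
    filter_upwards [hB.ae_pathLim] with ω hω t
    simp only [N, Y, hω, expMart]
  set K : ℝ≥0 × (WithTop ℝ≥0) → ℝ≥0∞ := fun p =>
    if p.2 < (p.1 : WithTop ℝ≥0) then ENNReal.ofReal (Real.exp ((μ - r) * p.1)) else 0
  have hK : Measurable K := Measurable.ite
    (measurableSet_lt (by fun_prop) (WithTop.measurable_coe.comp measurable_fst)) (by fun_prop)
    measurable_const
  have hf : Measurable (fun p : ℝ≥0 × ((ℝ≥0 → ℝ) × WithTop ℝ≥0) =>
      K (p.1, p.2.2) * N (p.1, p.2.1)) := by fun_prop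
  have hf' : Measurable (fun p : ℝ≥0 × ((ℝ≥0 → ℝ) × WithTop ℝ≥0) =>
      K (p.1, p.2.2) * N (p.2.2.untopD 0, p.2.1)) := by fun_prop
  -- For frozen `t`, the kernel `K (t, τ)` is a constant times the indicator of `{τ < t}`, so the
  -- sampling identity moves the martingale from `t` back to `τ`.
  have hslice : ∀ t : ℝ≥0, ∫⁻ ω, K (t, τ ω) * N (t, (Y ω).1) ∂P
      = ∫⁻ ω, K (t, τ ω) * N ((τ ω).untopD 0, (Y ω).1) ∂P := fun t => by
    have key := lintegral_stopped_lt (hB.martingale_expMart σ) (hB.continuous_expMart σ)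
      (fun s ω => (expMart_pos σ B s ω).le) hτ t
    have hA : MeasurableSet {ω | τ ω < (t : WithTop ℝ≥0)} := 𝓕.le t _ (hτ.measurableSet_lt t)
    have e : ∀ s : Ω → ℝ≥0, ∫⁻ ω, K (t, τ ω) * N (s ω, (Y ω).1) ∂P
        = ENNReal.ofReal (Real.exp ((μ - r) * t) * x)
          * ∫⁻ ω in {ω | τ ω < (t : WithTop ℝ≥0)}, ENNReal.ofReal (expMart σ B (s ω) ω) ∂P := by
      intro s
      rw [← lintegral_const_mul' _ _ ENNReal.ofReal_ne_top, ← lintegral_indicator hA]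
      refine lintegral_congr_ae ?_
      filter_upwards [hNae] with ω hω
      rw [hω, Set.indicator_apply]
      simp only [K, Set.mem_ofPred_eq]
      split_ifs
      · rw [← ENNReal.ofReal_mul (by positivity), ← ENNReal.ofReal_mul (by positivity), mul_assoc]
      · simp
    rw [e (fun _ => t), e, key]
  calc _ = ∫⁻ ω, K (τ₀ ω, τ ω) * N (τ₀ ω, (Y ω).1) ∂P := by
        refine lintegral_congr_ae ?_
        filter_upwards [hNae] with ω hω
        rw [hω]
        simp only [K, wage_eq_expMart]
        split_ifs
        · rw [← ENNReal.ofReal_mul (by positivity), sub_mul, sub_eq_neg_add, Real.exp_add]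
          ring_nf
        · simp
    _ = ∫⁻ ω, ∫⁻ t, K (t, τ ω) * N (t, (Y ω).1) ∂(P.map τ₀) ∂P :=
        lintegral_comp_of_indepFun hm hY (hB.indepFun_path hind hτ) hf
    -- Sampling requires a deterministic `t`, so `ω` is integrated first; the order is exchanged
    -- back afterwards to evaluate the exponential tail.
    _ = ∫⁻ t, ∫⁻ ω, K (t, τ ω) * N (t, (Y ω).1) ∂P ∂(P.map τ₀) :=
        lintegral_lintegral_swap
          (hf.comp (measurable_snd.prodMk (hY.comp measurable_fst))).aemeasurable
    _ = ∫⁻ t, ∫⁻ ω, K (t, τ ω) * N ((τ ω).untopD 0, (Y ω).1) ∂P ∂(P.map τ₀) :=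
        lintegral_congr hslice
    _ = ∫⁻ ω, ∫⁻ t, K (t, τ ω) * N ((τ ω).untopD 0, (Y ω).1) ∂(P.map τ₀) ∂P :=
        lintegral_lintegral_swap
          (hf'.comp (measurable_fst.prodMk (hY.comp measurable_snd))).aemeasurable
    _ = _ := by
        rw [← lintegral_const_mul' _ _ ENNReal.ofReal_ne_top]
        refine lintegral_congr_ae ?_
        filter_upwards [hNae] with ω hω
        rw [hω, lintegral_mul_const' _ _ ENNReal.ofReal_ne_top]
        rw [show ∫⁻ t, K (t, τ ω) ∂(P.map τ₀) = _ from
          lintegral_exp_survival hlam hm hlaw (show μ - r < lam by linarith) (τ ω)]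
        have hpos : 0 < r + lam - μ := by linarith
        rw [show lam - (μ - r) = r + lam - μ by ring]
        split_ifs
        · rw [← ENNReal.ofReal_mul (by positivity), ← ENNReal.ofReal_mul (by positivity),
            wage_eq_expMart, show -(r + lam - μ) * (((τ ω).untopD 0 : ℝ≥0) : ℝ)
              = -(r + lam) * ((τ ω).untopD 0 : ℝ≥0) + μ * ((τ ω).untopD 0 : ℝ≥0) by ring,
            Real.exp_add]
          ring_nf
        · simp

end JobLoss

/-! ### Integrability of differences of nonnegative pieces. -/

section Integration

variable {P : Measure Ω}

/-- Nonnegative functions with the same Lebesgue integral are integrable simultaneously. -/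
lemma integrable_iff_of_lintegral_ofReal_eq {f g : Ω → ℝ} (hf : AEStronglyMeasurable f P)
    (hg : AEStronglyMeasurable g P) (hf0 : ∀ ω, 0 ≤ f ω) (hg0 : ∀ ω, 0 ≤ g ω)
    (h : ∫⁻ ω, ENNReal.ofReal (f ω) ∂P = ∫⁻ ω, ENNReal.ofReal (g ω) ∂P) :
    Integrable f P ↔ Integrable g P := by
  rw [← lintegral_ofReal_ne_top_iff_integrable hf (Eventually.of_forall hf0),
    ← lintegral_ofReal_ne_top_iff_integrable hg (Eventually.of_forall hg0), h]

lemma integral_eq_of_lintegral_ofReal_eq {f g : Ω → ℝ} (hf : AEStronglyMeasurable f P)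
    (hg : AEStronglyMeasurable g P) (hf0 : ∀ ω, 0 ≤ f ω) (hg0 : ∀ ω, 0 ≤ g ω)
    (h : ∫⁻ ω, ENNReal.ofReal (f ω) ∂P = ∫⁻ ω, ENNReal.ofReal (g ω) ∂P) :
    ∫ ω, f ω ∂P = ∫ ω, g ω ∂P := by
  rw [integral_eq_lintegral_of_nonneg_ae (Eventually.of_forall hf0) hf,
    integral_eq_lintegral_of_nonneg_ae (Eventually.of_forall hg0) hg, h]

/-- Since `p ≠ 0`, `d` is recovered from the difference and `a`. With `a` a wage piece, only the
premium piece matters for integrability. -/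
lemma integrable_affine_iff {a d : Ω → ℝ} (ha : Integrable a P) (b : ℝ) {p : ℝ} (hp : p ≠ 0) :
    Integrable (fun ω => b * a ω - p * d ω) P ↔ Integrable d P := by
  refine ⟨fun h => ?_, fun h => (ha.const_mul b).sub (h.const_mul p)⟩
  refine (((ha.const_mul b).sub h).const_mul p⁻¹).congr (Eventually.of_forall fun ω => ?_)
  simp only [Pi.sub_apply]
  field_simp
  ring

lemma integrable_max_affine {a d : Ω → ℝ} (ha : Integrable a P) (hd : AEStronglyMeasurable d P)
    (hd0 : ∀ ω, 0 ≤ d ω) (b : ℝ) {p : ℝ} (hp : 0 ≤ p) :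
    Integrable (fun ω => max (b * a ω - p * d ω) 0) P := by
  refine (ha.const_mul b).abs.mono
    (((ha.const_mul b).1.sub (hd.const_mul p)).sup aestronglyMeasurable_const)
    (Eventually.of_forall fun ω => ?_)
  rw [Real.norm_eq_abs, abs_of_nonneg (le_max_right _ _), Real.norm_eq_abs, abs_abs]
  have := mul_nonneg hp (hd0 ω)
  exact max_le (by linarith [le_abs_self (b * a ω)]) (abs_nonneg _)

end Integration

/-! ### Splitting both rewards into wage and premium pieces. -/

variable {P : Measure Ω} {𝓕 : Filtration ℝ≥0 mΩ} {B : ℝ≥0 → Ω → ℝ} {μ σ r lam x : ℝ} {τ₀ : Ω → ℝ≥0}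

/-- The discounted wage at the job loss is integrable, with explicit mean. -/
lemma integrable_wage_jobLoss [IsProbabilityMeasure P] (hB : IsFilteredBrownian B 𝓕 P) (hlam : 0 < lam)
    (hm : Measurable τ₀) (hlaw : HasLaw (fun ω => (τ₀ ω : ℝ)) (expMeasure lam) P)
    (hind : Indep (MeasurableSpace.comap τ₀ inferInstance) (⨆ t, 𝓕 t) P)
    (hμ : μ < r + lam) (hx : 0 < x) :
    Integrable (fun ω => Real.exp (-r * τ₀ ω) * wage μ σ B x (τ₀ ω) ω) P ∧
      ∫ ω, Real.exp (-r * τ₀ ω) * wage μ σ B x (τ₀ ω) ω ∂P = lam / (r + lam - μ) * x := by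
  have hpos : 0 < r + lam - μ := by linarith
  have h0 : ∀ ω, 0 ≤ Real.exp (-r * τ₀ ω) * wage μ σ B x (τ₀ ω) ω := fun ω => by
    unfold wage
    positivity
  have hmeas : AEStronglyMeasurable
      (fun ω => Real.exp (-r * τ₀ ω) * wage μ σ B x (τ₀ ω) ω) P :=
    ((by fun_prop : AEMeasurable (fun ω => Real.exp (-r * τ₀ ω)) P).mul
      (hB.aemeasurable_wage μ σ x hm)).aestronglyMeasurable
  have key : ∫⁻ ω, ENNReal.ofReal (Real.exp (-r * τ₀ ω) * wage μ σ B x (τ₀ ω) ω) ∂P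
      = ENNReal.ofReal (lam / (r + lam - μ) * x) := by
    -- Take `τ = 0`: since `τ₀ > 0` almost surely, the entry event has full probability.
    have h := lintegral_wage_entry (σ := σ) hB hlam hm hlaw hind hμ hx
      (isStoppingTime_const 𝓕 (0 : ℝ≥0))
    have hX : ∫⁻ ω, ENNReal.ofReal (if ((0 : ℝ≥0) : WithTop ℝ≥0) < ⊤ then
        Real.exp (-(r + lam) * (((0 : ℝ≥0) : WithTop ℝ≥0).untopD 0 : ℝ≥0))
          * wage μ σ B x (((0 : ℝ≥0) : WithTop ℝ≥0).untopD 0) ω else 0) ∂P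
        = ENNReal.ofReal x := by
      rw [lintegral_congr_ae (g := fun _ => ENNReal.ofReal x), lintegral_const, measure_univ,
        mul_one]
      filter_upwards [hB.eval_zero_ae_eq_zero] with ω hω
      rw [if_pos (WithTop.coe_lt_top _)]
      simp [wage, hω]
    rw [hX, ← ENNReal.ofReal_mul (by positivity)] at h
    rw [← h]
    refine lintegral_congr_ae ?_
    filter_upwards [ae_pos_of_expMeasure hlaw] with ω hω
    rw [if_pos (WithTop.coe_lt_coe.2 hω)]
  constructor
  · rw [← lintegral_ofReal_ne_top_iff_integrable hmeas (Eventually.of_forall h0), key]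
    exact ENNReal.ofReal_ne_top
  · rw [integral_eq_lintegral_of_nonneg_ae (Eventually.of_forall h0) hmeas, key,
      ENNReal.toReal_ofReal (by positivity)]

open scoped Classical in
/-- The discounted wage at the job loss, on the event of entry at `τ`. -/
noncomputable def wageAtLoss (μ σ r : ℝ) (B : ℝ≥0 → Ω → ℝ) (τ₀ : Ω → ℝ≥0) (x : ℝ) (τ : Ω → WithTop ℝ≥0)
    (ω : Ω) : ℝ :=
  if τ ω < (τ₀ ω : WithTop ℝ≥0) then Real.exp (-r * τ₀ ω) * wage μ σ B x (τ₀ ω) ω else 0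

open scoped Classical in
/-- The discount factor at the entry time `τ`, on the event of entry before the job loss. -/
noncomputable def discountAtEntry (r : ℝ) (τ₀ : Ω → ℝ≥0) (τ : Ω → WithTop ℝ≥0) (ω : Ω) : ℝ :=
  if τ ω < (τ₀ ω : WithTop ℝ≥0) then Real.exp (-r * ((τ ω).untopD 0 : ℝ≥0)) else 0

lemma entryValue_eq (β prem : ℝ) (τ : Ω → WithTop ℝ≥0) :
    entryValue μ σ r β prem B τ₀ x τ
      = fun ω => β * wageAtLoss μ σ r B τ₀ x τ ω - prem * discountAtEntry r τ₀ τ ω := by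
  ext ω
  simp only [entryValue, wageAtLoss, discountAtEntry]
  split_ifs
  · rw [show -r * (τ₀ ω : ℝ) = -r * ((τ ω).untopD 0 : ℝ≥0)
      + -r * ((τ₀ ω : ℝ) - ((τ ω).untopD 0 : ℝ≥0)) by ring, Real.exp_add]
    ring
  · simp

lemma perpetualReward_affine (hx : 0 < x) (ρ b prem : ℝ) {g : ℝ → ℝ}
    (hg : ∀ y, 0 < y → g y = b * y - prem) (τ : Ω → WithTop ℝ≥0) :
    perpetualReward μ σ ρ g B x τ
      = fun ω => b * perpetualReward μ σ ρ id B x τ ω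
        - prem * perpetualReward μ σ ρ (fun _ => 1) B x τ ω := by
  ext ω
  simp only [perpetualReward, id]
  split_ifs
  · rw [hg _ (by unfold wage; positivity)]
    ring
  · simp

lemma wageAtLoss_nonneg (hx : 0 < x) (τ : Ω → WithTop ℝ≥0) (ω : Ω) :
    0 ≤ wageAtLoss μ σ r B τ₀ x τ ω := by
  unfold wageAtLoss wage
  split_ifs <;> positivity

lemma wageAtLoss_le (hx : 0 < x) (τ : Ω → WithTop ℝ≥0) (ω : Ω) :
    wageAtLoss μ σ r B τ₀ x τ ω ≤ Real.exp (-r * τ₀ ω) * wage μ σ B x (τ₀ ω) ω := by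
  unfold wageAtLoss wage
  split_ifs
  · rfl
  · positivity

lemma discountAtEntry_nonneg (τ : Ω → WithTop ℝ≥0) (ω : Ω) : 0 ≤ discountAtEntry r τ₀ τ ω := by
  unfold discountAtEntry
  split_ifs <;> positivity

lemma perpetualReward_id_nonneg (hx : 0 < x) (ρ : ℝ) (τ : Ω → WithTop ℝ≥0) (ω : Ω) :
    0 ≤ perpetualReward μ σ ρ id B x τ ω := by
  unfold perpetualReward wage
  split_ifs
  · simp only [id]
    positivity
  · rfl

lemma perpetualReward_one_nonneg (ρ : ℝ) (τ : Ω → WithTop ℝ≥0) (ω : Ω) :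
    0 ≤ perpetualReward μ σ ρ (fun _ => 1) B x τ ω := by
  unfold perpetualReward
  split_ifs <;> positivity

section Measurability

variable {τ : Ω → WithTop ℝ≥0}

lemma measurableSet_lt_jobLoss (hm : Measurable τ₀) (hτ : IsStoppingTime 𝓕 τ) :
    MeasurableSet {ω | τ ω < (τ₀ ω : WithTop ℝ≥0)} :=
  measurableSet_lt hτ.measurable' (WithTop.measurable_coe.comp hm)

lemma measurableSet_lt_top (hτ : IsStoppingTime 𝓕 τ) : MeasurableSet {ω | τ ω < ⊤} :=
  measurableSet_lt hτ.measurable' measurable_const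

lemma aestronglyMeasurable_wageAtLoss (hB : IsFilteredBrownian B 𝓕 P) (hm : Measurable τ₀)
    (hτ : IsStoppingTime 𝓕 τ) : AEStronglyMeasurable (wageAtLoss μ σ r B τ₀ x τ) P := by
  have h : AEMeasurable (fun ω => Real.exp (-r * τ₀ ω) * wage μ σ B x (τ₀ ω) ω) P :=
    (by fun_prop : AEMeasurable (fun ω => Real.exp (-r * τ₀ ω)) P).mul
      (hB.aemeasurable_wage μ σ x hm)
  refine (h.indicator (measurableSet_lt_jobLoss hm hτ)).aestronglyMeasurable.congr
    (Eventually.of_forall fun ω => ?_)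
  by_cases hω : τ ω < (τ₀ ω : WithTop ℝ≥0)
  · exact (Set.indicator_of_mem (s := {ω | τ ω < (τ₀ ω : WithTop ℝ≥0)}) hω _).trans
      (if_pos hω).symm
  · exact (Set.indicator_of_notMem (s := {ω | τ ω < (τ₀ ω : WithTop ℝ≥0)}) hω _).trans
      (if_neg hω).symm

lemma measurable_discountAtEntry (hm : Measurable τ₀) (hτ : IsStoppingTime 𝓕 τ) :
    Measurable (discountAtEntry r τ₀ τ) := by
  have := hτ.measurable'
  exact Measurable.ite (measurableSet_lt_jobLoss hm hτ) (by fun_prop) measurable_const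

lemma aestronglyMeasurable_perpetualReward_id (hB : IsFilteredBrownian B 𝓕 P) (ρ : ℝ)
    (hτ : IsStoppingTime 𝓕 τ) : AEStronglyMeasurable (perpetualReward μ σ ρ id B x τ) P := by
  have hτm := hτ.measurable'
  have hu : Measurable (fun ω => (τ ω).untopD 0) := by fun_prop
  have h : AEMeasurable (fun ω => Real.exp (-ρ * ((τ ω).untopD 0 : ℝ≥0))
      * wage μ σ B x ((τ ω).untopD 0) ω) P :=
    (by fun_prop : AEMeasurable (fun ω => Real.exp (-ρ * ((τ ω).untopD 0 : ℝ≥0))) P).mul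
      (hB.aemeasurable_wage μ σ x hu)
  refine (h.indicator (measurableSet_lt_top hτ)).aestronglyMeasurable.congr
    (Eventually.of_forall fun ω => ?_)
  by_cases hω : τ ω < ⊤ <;> simp [perpetualReward, hω]

lemma measurable_perpetualReward_one (ρ : ℝ) (hτ : IsStoppingTime 𝓕 τ) :
    Measurable (perpetualReward μ σ ρ (fun _ => 1) B x τ) := by
  have := hτ.measurable'
  exact Measurable.ite (measurableSet_lt_top hτ) (by fun_prop) measurable_const

lemma integrable_perpetualReward_one [IsFiniteMeasure P] {ρ : ℝ} (hρ : 0 ≤ ρ)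
    (hτ : IsStoppingTime 𝓕 τ) :
    Integrable (perpetualReward μ σ ρ (fun _ => 1) B x τ) P := by
  refine Integrable.of_bound (measurable_perpetualReward_one ρ hτ).aestronglyMeasurable 1
    (Eventually.of_forall fun ω => ?_)
  rw [Real.norm_eq_abs, abs_of_nonneg (perpetualReward_one_nonneg ρ τ ω)]
  unfold perpetualReward
  split_ifs
  · rw [mul_one, Real.exp_le_one_iff, neg_mul, neg_nonpos]
    positivity
  · exact zero_le_one

end Measurability

end UnemploymentInsurance

/-! ### Optimal entry as a perpetual stopping problem. -/

theorem mainTheorem2 {Ω : Type*} [mΩ : MeasurableSpace Ω] (P : Measure Ω) [IsProbabilityMeasure P]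
    (𝓕 : Filtration ℝ≥0 mΩ) (B : ℝ≥0 → Ω → ℝ)
    (hB : UnemploymentInsurance.IsFilteredBrownian B 𝓕 P)
    (μ σ r lam₀ lam₁ prem : ℝ) (hσ : 0 < σ) (hlam₀ : 0 < lam₀) (hlam₁ : 0 < lam₁)
    (hprem : 0 < prem) (hμ : μ < r + lam₀)
    -- the job-loss time: exponential with rate `lam₀`, independent of the wage information
    (τ₀ : Ω → ℝ≥0) (hτ₀_meas : Measurable τ₀)
    (hτ₀_law : HasLaw (fun ω => (τ₀ ω : ℝ)) (expMeasure lam₀) P)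
    (hτ₀_indep : Indep (MeasurableSpace.comap τ₀ inferInstance) (⨆ t, 𝓕 t) P)
    -- the benefit schedule, for which the integrals defining `H` and `β` converge
    (h : ℝ → ℝ)
    (hh : ∀ t, 0 ≤ t → IntervalIntegrable (fun s => Real.exp (-r * s) * h s) volume 0 t)
    (hβ : IntegrableOn (fun t => lam₁ * Real.exp (-lam₁ * t) *
      UnemploymentInsurance.discountedSchedule r h t) (Set.Ioi 0))
    (β : ℝ) (hβ_def : β = UnemploymentInsurance.benefitFactor r lam₁ h)
    (g : ℝ → ℝ) (hg_def : g = UnemploymentInsurance.gain P μ σ r β prem B τ₀)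
    (x : ℝ) (hx : 0 < x) :
    -- the gain function is well defined and affine
    (∀ y, 0 < y → Integrable (UnemploymentInsurance.discountedBenefit μ σ r β B τ₀ y) P ∧
      g y = β * lam₀ / (r + lam₀ - μ) * y - prem) ∧
    -- the perpetual representation, for every stopping time; both expectations are well defined
    -- in `[-∞, ∞)` and are finite simultaneously, always so if `0 ≤ r + lam₀`
    (∀ τ : Ω → WithTop ℝ≥0, IsStoppingTime 𝓕 τ →
      Integrable
        (fun ω => max (UnemploymentInsurance.entryValue μ σ r β prem B τ₀ x τ ω) 0) P ∧
      Integrable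
        (fun ω => max (UnemploymentInsurance.perpetualReward μ σ (r + lam₀) g B x τ ω) 0) P ∧
      (Integrable (UnemploymentInsurance.entryValue μ σ r β prem B τ₀ x τ) P ↔
        Integrable (UnemploymentInsurance.perpetualReward μ σ (r + lam₀) g B x τ) P) ∧
      (0 ≤ r + lam₀ →
        Integrable (UnemploymentInsurance.entryValue μ σ r β prem B τ₀ x τ) P) ∧
      UnemploymentInsurance.eNPV P μ σ r β prem B τ₀ x τ =
        ∫ ω, UnemploymentInsurance.perpetualReward μ σ (r + lam₀) g B x τ ω ∂P) ∧
    -- the problem of optimal entry and the perpetual stopping problem have the same (finite) value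
    (∃ v : ℝ,
      IsLUB {c | ∃ τ : Ω → WithTop ℝ≥0, IsStoppingTime 𝓕 τ ∧
        Integrable (UnemploymentInsurance.entryValue μ σ r β prem B τ₀ x τ) P ∧
        c = UnemploymentInsurance.eNPV P μ σ r β prem B τ₀ x τ} v ∧
      IsLUB {c | ∃ τ : Ω → WithTop ℝ≥0, IsStoppingTime 𝓕 τ ∧
        Integrable (UnemploymentInsurance.perpetualReward μ σ (r + lam₀) g B x τ) P ∧
        c = ∫ ω, UnemploymentInsurance.perpetualReward μ σ (r + lam₀) g B x τ ω ∂P} v) := by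
  have hpos : 0 < r + lam₀ - μ := by linarith
  have hκ : 0 < lam₀ / (r + lam₀ - μ) := by positivity
  have hloss := fun {y : ℝ} (hy : 0 < y) =>
    UnemploymentInsurance.integrable_wage_jobLoss (σ := σ) hB hlam₀ hτ₀_meas hτ₀_law hτ₀_indep
      hμ hy
  have hben : ∀ y, UnemploymentInsurance.discountedBenefit μ σ r β B τ₀ y = fun ω =>
      β * (Real.exp (-r * τ₀ ω) * UnemploymentInsurance.wage μ σ B y (τ₀ ω) ω) := fun y => by
    ext ω
    rw [UnemploymentInsurance.discountedBenefit]
    ring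
  have hg : ∀ y, 0 < y → g y = β * lam₀ / (r + lam₀ - μ) * y - prem := fun y hy => by
    rw [hg_def, UnemploymentInsurance.gain, hben, integral_const_mul, (hloss hy).2]
    ring
  have hwageInt : ∀ τ : Ω → WithTop ℝ≥0, IsStoppingTime 𝓕 τ →
      Integrable (UnemploymentInsurance.wageAtLoss μ σ r B τ₀ x τ) P := fun τ hτ => by
    refine (hloss hx).1.mono (UnemploymentInsurance.aestronglyMeasurable_wageAtLoss hB hτ₀_meas hτ)
      (Filter.Eventually.of_forall fun ω => ?_)
    rw [Real.norm_eq_abs, abs_of_nonneg (UnemploymentInsurance.wageAtLoss_nonneg hx τ ω)]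
    exact (UnemploymentInsurance.wageAtLoss_le hx τ ω).trans (le_abs_self _)
  have hmain : ∀ τ : Ω → WithTop ℝ≥0, IsStoppingTime 𝓕 τ →
      Integrable
        (fun ω => max (UnemploymentInsurance.entryValue μ σ r β prem B τ₀ x τ ω) 0) P ∧
      Integrable
        (fun ω => max (UnemploymentInsurance.perpetualReward μ σ (r + lam₀) g B x τ ω) 0) P ∧
      (Integrable (UnemploymentInsurance.entryValue μ σ r β prem B τ₀ x τ) P ↔
        Integrable (UnemploymentInsurance.perpetualReward μ σ (r + lam₀) g B x τ) P) ∧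
      (0 ≤ r + lam₀ →
        Integrable (UnemploymentInsurance.entryValue μ σ r β prem B τ₀ x τ) P) ∧
      UnemploymentInsurance.eNPV P μ σ r β prem B τ₀ x τ =
        ∫ ω, UnemploymentInsurance.perpetualReward μ σ (r + lam₀) g B x τ ω ∂P := by
    intro τ hτ
    have ha := hwageInt τ hτ
    have hGm := UnemploymentInsurance.aestronglyMeasurable_perpetualReward_id (μ := μ) (σ := σ) (x := x) hB
      (r + lam₀) hτ
    have hG0 := UnemploymentInsurance.perpetualReward_id_nonneg (μ := μ) (σ := σ) (B := B) hx
      (r + lam₀) τ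
    have hlin := UnemploymentInsurance.lintegral_wage_entry (σ := σ) hB hlam₀ hτ₀_meas hτ₀_law
      hτ₀_indep hμ hx hτ
    have hlin' : ∫⁻ ω, ENNReal.ofReal (UnemploymentInsurance.wageAtLoss μ σ r B τ₀ x τ ω) ∂P
        = ∫⁻ ω, ENNReal.ofReal (lam₀ / (r + lam₀ - μ) *
          UnemploymentInsurance.perpetualReward μ σ (r + lam₀) id B x τ ω) ∂P := by
      simp only [ENNReal.ofReal_mul hκ.le]
      rw [lintegral_const_mul' _ _ ENNReal.ofReal_ne_top]
      exact hlin
    have ha0 := UnemploymentInsurance.wageAtLoss_nonneg (μ := μ) (σ := σ) (r := r) (B := B)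
      (τ₀ := τ₀) hx τ
    have hκG0 := fun ω => mul_nonneg hκ.le (hG0 ω)
    have hκG : Integrable (fun ω => lam₀ / (r + lam₀ - μ) *
        UnemploymentInsurance.perpetualReward μ σ (r + lam₀) id B x τ ω) P :=
      (UnemploymentInsurance.integrable_iff_of_lintegral_ofReal_eq ha.1 (hGm.const_mul _) ha0
        hκG0 hlin').1 ha
    have hmean := UnemploymentInsurance.integral_eq_of_lintegral_ofReal_eq ha.1 (hGm.const_mul _)
      ha0 hκG0 hlin'
    rw [integral_const_mul] at hmean
    have hG : Integrable (UnemploymentInsurance.perpetualReward μ σ (r + lam₀) id B x τ) P :=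
      (integrable_const_mul_iff hκ.ne'.isUnit _).1 hκG
    have hdm := (UnemploymentInsurance.measurable_discountAtEntry (r := r) hτ₀_meas
      hτ).aestronglyMeasurable (μ := P)
    have hDm := (UnemploymentInsurance.measurable_perpetualReward_one (μ := μ) (σ := σ) (B := B)
      (x := x) (r + lam₀) hτ).aestronglyMeasurable (μ := P)
    have hd0 := UnemploymentInsurance.discountAtEntry_nonneg (r := r) (τ₀ := τ₀) τ
    have hD0 := UnemploymentInsurance.perpetualReward_one_nonneg (μ := μ) (σ := σ) (B := B)
      (x := x) (r + lam₀) τ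
    have hlinD : ∫⁻ ω, ENNReal.ofReal (UnemploymentInsurance.discountAtEntry r τ₀ τ ω) ∂P
        = ∫⁻ ω, ENNReal.ofReal (UnemploymentInsurance.perpetualReward μ σ (r + lam₀)
          (fun _ => 1) B x τ ω) ∂P := by
      refine (UnemploymentInsurance.lintegral_discount_entry hB hlam₀ hτ₀_meas hτ₀_law
        hτ₀_indep r hτ).trans ?_
      simp only [UnemploymentInsurance.perpetualReward, mul_one]
    have hdD := UnemploymentInsurance.integrable_iff_of_lintegral_ofReal_eq hdm hDm hd0 hD0 hlinD
    have hmeanD := UnemploymentInsurance.integral_eq_of_lintegral_ofReal_eq hdm hDm hd0 hD0 hlinD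
    rw [UnemploymentInsurance.eNPV, UnemploymentInsurance.entryValue_eq,
      UnemploymentInsurance.perpetualReward_affine hx (r + lam₀) _ prem hg τ]
    have hL := UnemploymentInsurance.integrable_affine_iff
      (d := UnemploymentInsurance.discountAtEntry r τ₀ τ) ha β hprem.ne'
    have hR := UnemploymentInsurance.integrable_affine_iff
      (d := UnemploymentInsurance.perpetualReward μ σ (r + lam₀) (fun _ => 1) B x τ) hG
      (β * lam₀ / (r + lam₀ - μ)) hprem.ne'
    refine ⟨UnemploymentInsurance.integrable_max_affine ha hdm hd0 _ hprem.le,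
      UnemploymentInsurance.integrable_max_affine hG hDm hD0 _ hprem.le,
      (hL.trans hdD).trans hR.symm, fun hρ => ?_, ?_⟩
    · exact (hL.trans hdD).2 (UnemploymentInsurance.integrable_perpetualReward_one hρ hτ)
    · by_cases hd : Integrable (UnemploymentInsurance.discountAtEntry r τ₀ τ) P
      · rw [integral_sub (ha.const_mul _) (hd.const_mul _),
          integral_sub (hG.const_mul _) ((hdD.1 hd).const_mul _), integral_const_mul,
          integral_const_mul, integral_const_mul, integral_const_mul, hmean, hmeanD]
        ring
      -- Neither side is integrable, so both Bochner integrals are 0 by convention, standing for two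
      -- expectations equal to `-∞`.
      · rw [integral_undef (mt hL.1 hd), integral_undef (mt (hR.trans hdD.symm).1 hd)]
  refine ⟨fun y hy => ⟨?_, hg y hy⟩, hmain, ?_⟩
  · rw [hben]
    exact (hloss hy).1.const_mul β
  have hsets : {c | ∃ τ : Ω → WithTop ℝ≥0, IsStoppingTime 𝓕 τ ∧
        Integrable (UnemploymentInsurance.perpetualReward μ σ (r + lam₀) g B x τ) P ∧
        c = ∫ ω, UnemploymentInsurance.perpetualReward μ σ (r + lam₀) g B x τ ω ∂P}
      = {c | ∃ τ : Ω → WithTop ℝ≥0, IsStoppingTime 𝓕 τ ∧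
        Integrable (UnemploymentInsurance.entryValue μ σ r β prem B τ₀ x τ) P ∧
        c = UnemploymentInsurance.eNPV P μ σ r β prem B τ₀ x τ} := by
    ext c
    refine exists_congr fun τ => and_congr_right fun hτ => ?_
    obtain ⟨-, -, hiff, -, heq⟩ := hmain τ hτ
    rw [hiff, heq]
  rw [hsets]
  refine (fun h => ⟨_, h, h⟩) (isLUB_csSup ?_ ?_)
  -- Never entering is admissible and has value 0.
  · refine ⟨_, fun _ => ⊤, fun t => ?_, ?_, rfl⟩
    · simp
    · rw [show UnemploymentInsurance.entryValue μ σ r β prem B τ₀ x (fun _ => ⊤) = fun _ => 0 by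
        ext ω
        exact if_neg not_top_lt]
      exact integrable_zero _ _ _
  -- Dropping the premium and the restriction to `{τ < τ₀}` bounds every value by `|β|` times the
  -- mean discounted wage at the job loss; the absolute value covers negative `β`.
  · refine ⟨|β| * (lam₀ / (r + lam₀ - μ) * x), ?_⟩
    rintro c ⟨τ, hτ, hint, rfl⟩
    rw [← (hloss hx).2, ← integral_const_mul]
    refine integral_mono hint ((hloss hx).1.const_mul _) fun ω => ?_
    simp only [UnemploymentInsurance.entryValue_eq]
    have h1 := mul_nonneg hprem.le
      (UnemploymentInsurance.discountAtEntry_nonneg (r := r) (τ₀ := τ₀) τ ω)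
    have h2 := mul_le_mul (le_abs_self β)
      (UnemploymentInsurance.wageAtLoss_le (μ := μ) (σ := σ) (r := r) (B := B) (τ₀ := τ₀) hx τ ω)
      (UnemploymentInsurance.wageAtLoss_nonneg hx τ ω) (abs_nonneg β)
    linarith
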